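/- Let $F$ be a field, let $R$ be an associative unital $F$-algebra and let $X$ be a nonempty set. For every $x\in X$ let $\sigma_x$ be an automorphism of the $F$-algebra $R$ and let $\delta_x\colon R\to R$ be a $\sigma_x$-derivation, that is, an additive map with $\delta_x(ab)=\delta_x(a)b+\sigma_x(a)\delta_x(b)$ for all $a,b\in R$. Put $\mathscr{G}=\{\sigma_x\}_{x\in X}$ and $\mathscr{D}=\{\delta_x\}_{x\in X}$. Let $S=R[X;\mathscr{G},\mathscr{D}]$ be the free skew extension of $R$, i.e. a ring that contains $R$ as a subring and contains the elements $x\in X$, that is a free left $R$-module with basis the set of words of the free monoid $\langle X\rangle$, and in which $xr=\sigma_x(r)x+\delta_x(r)$ for all $x\in X$, $r\in R$. Let $P(R)$ be the prime radical of $R$ (the intersection of all prime ideals). For $q\in F$ put $(n!)_q=\prod_{i=1}^n(1+q+\cdots+q^{i-1})$. Suppose that 1. $P(R)$ is nilpotent, with index of nilpotency equal to $n$ (the least $n$ with $P(R)^n=0$); 2. $R/P(R)$ is left Goldie, i.e. it contains no infinite direct sum of nonzero left ideals and satisfies the ascending chain condition on left annihilators; 3. for every $x\in X$ there is a nonzero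 $q_x\in F$ with $\delta_x\sigma_x=q_x\sigma_x\delta_x$ and $(n!)_{q_x}\neq 0$ in $F$. Then the Jacobson radical $J(R[X;\mathscr{G},\mathscr{D}])$ is nilpotent. -/

import Mathlib

/-- `δ` is a `σ`-derivation of the ring `R`: an additive map satisfying the `σ`-Leibniz rule. -/
def IsSkewDerivation {R : Type*} [Ring R] (σ : R →+* R) (δ : R →+ R) : Prop :=
  ∀ a b : R, δ (a * b) = δ a * b + σ a * δ b

/-- The ring `S`, with the inclusion `ι : R → S` and the elements `v x` (`x ∈ X`), is a free skew
extension `R[X; σ, δ]`: `R` is a subring of `S`, the words in the `v x` form a basis of `S` as a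
left `R`-module (every element of `S` is in exactly one way a finite sum `∑ r_w w` over words
`w ∈ ⟨X⟩`), and `x r = σ_x(r) x + δ_x(r)`. -/
structure IsFreeSkewExtension {R X S : Type*} [Ring R] [Ring S] (σ : X → R →+* R)
    (δ : X → R →+ R) (ι : R →+* S) (v : X → S) : Prop where
  injective : Function.Injective ι
  basis : Function.Bijective (fun f : FreeMonoid X →₀ R =>
    f.sum (fun w r => ι r * FreeMonoid.lift v w))
  commutation : ∀ (x : X) (r : R), v x * ι r = ι (σ x r) * v x + ι (δ x r)

/-- A prime (two-sided) ideal of a possibly noncommutative ring: a proper two-sided ideal `P` such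
that `a R b ⊆ P` implies `a ∈ P` or `b ∈ P`. -/
structure IsTwoSidedPrime {R : Type*} [Ring R] (P : Ideal R) : Prop where
  isTwoSided : P.IsTwoSided
  ne_top : P ≠ ⊤
  mem_or_mem : ∀ a b : R, (∀ r : R, a * r * b ∈ P) → a ∈ P ∨ b ∈ P

/-- The prime radical: the intersection of all prime ideals. -/
def primeRadical (R : Type*) [Ring R] : Ideal R :=
  sInf {P : Ideal R | IsTwoSidedPrime P}

instance primeRadical_isTwoSided (R : Type*) [Ring R] : (primeRadical R).IsTwoSided where
  mul_mem_of_left := by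
    intro a b ha
    simp only [primeRadical, Submodule.mem_sInf, Set.mem_ofPred_eq] at ha ⊢
    intro P hP
    have := hP.isTwoSided
    exact Ideal.mul_mem_right b P (ha P hP)

/-- The left annihilator `{r | r A = 0}` of a subset `A` of a ring. -/
def leftAnnihilator {R : Type*} [Ring R] (A : Set R) : Ideal R where
  carrier := {r | ∀ a ∈ A, r * a = 0}
  add_mem' := by
    intro r s hr hs a ha
    rw [add_mul, hr a ha, hs a ha, add_zero]
  zero_mem' := fun a _ => zero_mul a
  smul_mem' := by
    intro c r hr a ha
    rw [smul_eq_mul, mul_assoc, hr a ha, mul_zero]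

/-- A left Goldie ring: there is no infinite direct sum of nonzero left ideals, and every ascending
chain of left annihilators becomes stationary. (`Ideal R` is the type of left ideals.) -/
structure IsLeftGoldie (R : Type*) [Ring R] : Prop where
  no_infinite_direct_sum : ¬ ∃ L : ℕ → Ideal R, (∀ i, L i ≠ ⊥) ∧ iSupIndep L
  acc_leftAnnihilator : ∀ A : ℕ → Set R, Monotone (fun i => leftAnnihilator (A i)) →
    ∃ N, ∀ m, N ≤ m → leftAnnihilator (A m) = leftAnnihilator (A N)

/-- The `q`-factorial `(n!)_q = ∏_{i=1}^n (1 + q + ⋯ + q^{i-1})`. -/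
def qFactorial {F : Type*} [Field F] (q : F) (n : ℕ) : F :=
  ∏ i ∈ Finset.Icc 1 n, ∑ j ∈ Finset.range i, q ^ j

/-- The additive endomorphism `∑ r_w w ↦ ∑ (σ_x(r_w) x w + δ_x(r_w) w)`, which is the left
multiplication by `x` in the free skew extension. -/
noncomputable def skewVarEnd {R X : Type*} [Ring R] (σ : X → R →+* R) (δ : X → R →+ R) (x : X) :
    AddMonoid.End (FreeMonoid X →₀ R) :=
  Finsupp.liftAddHom (fun w =>
    (Finsupp.singleAddHom (FreeMonoid.of x * w)).comp (σ x).toAddMonoidHom +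
      (Finsupp.singleAddHom w).comp (δ x))

/-- Free skew extensions exist. -/
theorem exists_isFreeSkewExtension.{u, w} {R : Type u} {X : Type w} [Ring R] (σ : X → R →+* R)
    (δ : X → R →+ R) (hδ : ∀ x, IsSkewDerivation (σ x) (δ x)) :
    ∃ (S : Type (max u w)) (_ : Ring S) (ι : R →+* S) (v : X → S),
      IsFreeSkewExtension σ δ ι v := by
  let E := AddMonoid.End (FreeMonoid X →₀ R)
  let ιE : R →+* E := Module.toAddMonoidEnd R (FreeMonoid X →₀ R)
  let vE : X → E := skewVarEnd σ δ
  have hι : ∀ (r : R) (w : FreeMonoid X) (s : R),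
      ιE r (Finsupp.single w s) = Finsupp.single w (r * s) := by
    intro r w s
    exact Finsupp.smul_single r w s
  have hv : ∀ (x : X) (w : FreeMonoid X) (s : R), vE x (Finsupp.single w s) =
      Finsupp.single (FreeMonoid.of x * w) (σ x s) + Finsupp.single w (δ x s) := by
    intro x w s
    exact Finsupp.liftAddHom_apply_single _ w s
  have hcomm : ∀ (x : X) (r : R), vE x * ιE r = ιE (σ x r) * vE x + ιE (δ x r) := by
    intro x r
    apply Finsupp.addHom_ext
    intro w s
    change vE x (ιE r (Finsupp.single w s)) =
      ιE (σ x r) (vE x (Finsupp.single w s)) + ιE (δ x r) (Finsupp.single w s)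
    rw [hι, hv, hv, map_add, hι, hι, hι, hδ x r s, map_mul, Finsupp.single_add]
    abel
  let S : Subring E := Subring.closure (Set.range ιE ∪ Set.range vE)
  have hιS : ∀ r, ιE r ∈ S := fun r => Subring.subset_closure (Or.inl ⟨r, rfl⟩)
  have hvS : ∀ x, vE x ∈ S := fun x => Subring.subset_closure (Or.inr ⟨x, rfl⟩)
  let ι : R →+* S := ιE.codRestrict S hιS
  let v : X → S := fun x => ⟨vE x, hvS x⟩
  have hcommS : ∀ (x : X) (r : R), v x * ι r = ι (σ x r) * v x + ι (δ x r) := by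
    intro x r
    exact Subtype.ext (hcomm x r)
  let Φ : (FreeMonoid X →₀ R) →+ S := Finsupp.liftAddHom (fun w =>
    (AddMonoidHom.mulRight (FreeMonoid.lift v w)).comp ι.toAddMonoidHom)
  have hΦ : ∀ f, Φ f = f.sum (fun w r => ι r * FreeMonoid.lift v w) := fun f => rfl
  have hΦs : ∀ w r, Φ (Finsupp.single w r) = ι r * FreeMonoid.lift v w := by
    intro w r
    simp [Φ]
  have hιΦ : ∀ r f, ∃ g, ι r * Φ f = Φ g := by
    intro r f
    induction f using Finsupp.induction_linear with
    | zero => exact ⟨0, by simp⟩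
    | add f g hf hg =>
      obtain ⟨f', hf'⟩ := hf
      obtain ⟨g', hg'⟩ := hg
      exact ⟨f' + g', by rw [map_add, mul_add, hf', hg', map_add]⟩
    | single w s => exact ⟨Finsupp.single w (r * s), by rw [hΦs, hΦs, map_mul, mul_assoc]⟩
  have hvΦ : ∀ x f, ∃ g, v x * Φ f = Φ g := by
    intro x f
    induction f using Finsupp.induction_linear with
    | zero => exact ⟨0, by simp⟩
    | add f g hf hg =>
      obtain ⟨f', hf'⟩ := hf
      obtain ⟨g', hg'⟩ := hg
      exact ⟨f' + g', by rw [map_add, mul_add, hf', hg', map_add]⟩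
    | single w s =>
      refine ⟨Finsupp.single (FreeMonoid.of x * w) (σ x s) + Finsupp.single w (δ x s), ?_⟩
      rw [map_add, hΦs, hΦs, hΦs, ← mul_assoc, hcommS, map_mul, FreeMonoid.lift_eval_of,
        add_mul, mul_assoc]
  have hmul : ∀ s : S, ∀ f, ∃ g, s * Φ f = Φ g := by
    rintro ⟨s, hs⟩
    induction hs using Subring.closure_induction with
    | mem s hs =>
      intro f
      rcases hs with ⟨r, rfl⟩ | ⟨x, rfl⟩
      · exact hιΦ r f
      · exact hvΦ x f
    | zero => exact fun f => ⟨0, by rw [map_zero]; exact zero_mul _⟩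
    | one => exact fun f => ⟨f, one_mul _⟩
    | add s t hs ht h1 h2 =>
      intro f
      obtain ⟨f', hf'⟩ := h1 f
      obtain ⟨g', hg'⟩ := h2 f
      exact ⟨f' + g', by rw [map_add, ← hf', ← hg', ← add_mul]; rfl⟩
    | neg s hs h1 =>
      intro f
      obtain ⟨f', hf'⟩ := h1 f
      exact ⟨-f', by rw [map_neg, ← hf', ← neg_mul]; rfl⟩
    | mul s t hs ht h1 h2 =>
      intro f
      obtain ⟨f', hf'⟩ := h2 f
      obtain ⟨g', hg'⟩ := h1 f'
      exact ⟨g', by rw [← hg', ← hf', ← mul_assoc]; rfl⟩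
  have hword : ∀ w : FreeMonoid X, ((FreeMonoid.lift v w : S) : E) (Finsupp.single 1 1) =
      Finsupp.single w 1 := by
    intro w
    induction w using FreeMonoid.inductionOn' with
    | one => rfl
    | of_mul x w ih =>
      rw [map_mul, FreeMonoid.lift_eval_of]
      change vE x (((FreeMonoid.lift v w : S) : E) (Finsupp.single 1 1)) = _
      have h1 : δ x 1 = 0 := by simpa using hδ x 1 1
      rw [ih, hv, map_one, h1, Finsupp.single_zero, add_zero]
  have hev : ∀ f, ((Φ f : S) : E) (Finsupp.single 1 1) = f := by
    intro f
    induction f using Finsupp.induction_linear with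
    | zero => rw [map_zero]; rfl
    | add f g hf hg =>
      rw [map_add]
      change ((Φ f : S) : E) (Finsupp.single 1 1) + ((Φ g : S) : E) (Finsupp.single 1 1) = _
      rw [hf, hg]
    | single w s =>
      rw [hΦs]
      change ιE s (((FreeMonoid.lift v w : S) : E) (Finsupp.single 1 1)) = _
      rw [hword, hι, mul_one]
  have hinj : Function.Injective Φ := by
    intro f g h
    rw [← hev f, ← hev g, h]
  refine ⟨S, inferInstance, ι, v, ?_, ⟨hinj, ?_⟩, hcommS⟩
  · intro r s h
    have h1 : Φ (Finsupp.single 1 r) = Φ (Finsupp.single 1 s) := by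
      rw [hΦs, hΦs, h]
    exact Finsupp.single_injective _ (hinj h1)
  · intro s
    obtain ⟨g, hg⟩ := hmul s (Finsupp.single 1 1)
    refine ⟨g, ?_⟩
    change Φ g = s
    rw [← hg, hΦs, map_one, map_one, mul_one, mul_one]

/-! ### Regular elements in semiprime left Goldie rings -/

section Semiprime

variable {R : Type*} [Ring R]

/-! Write `P` for the prime radical of `R`. The proof shows that `P` is stable under every `δ x`,
that the Jacobson radical of `S` has all its coefficients in `P`, and that nilpotency of `P` then
passes to it.

Stability (`IsSkewDerivation.apply_mem_of_pow_eq_bot`): descending induction on `k` gives `δ^k(P^k)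
⊆ P`, starting from `P^n = 0` and ending at `k = 1`. Modulo `P` only two terms of the `q`-Leibniz
expansion of `δ^(k+1)(ab)` matter, and the factor `1 + q + ⋯ + q^k` in front of the second is
invertible because it divides `(n!)_q`. Semiprimeness of `P` finishes each step.

Coefficients: by stability, `S` maps onto the free skew extension of `R ⧸ P`, so it is enough that
the latter has zero Jacobson radical (`IsFreeSkewExtension.jacobson_eq_bot`). If `J ≠ 0` is that
radical, the annihilator `Q` of its top coefficients in large degree is stable under all `σ x` and
`δ x`. Goldie's argument yields `c` in the ideal `I` generated by these coefficients such that `b *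
c = 0` forces `b ∈ Q`. A suitable `f ∈ J`, whose top coefficients control `c`, makes `1 + c f` left
invertible. The part of the left inverse with coefficients in `Q` is killed by `c`, and comparing
top degrees shows that the rest cannot exist; then `1 ∈ Q`, which is absurd.

Nilpotency (`IsFreeSkewExtension.pow_eq_bot`): stability makes `P^k S` a two-sided ideal, and it
contains the `k`-th power of the radical. -/

theorem mem_leftAnnihilator {A : Set R} {r : R} : r ∈ leftAnnihilator A ↔ ∀ a ∈ A, r * a = 0 :=
  Iff.rfl

/-- The ascending chain condition on left annihilators, as well-foundedness. -/
theorem IsLeftGoldie.wellFoundedGT (h : IsLeftGoldie R) :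
    WellFoundedGT {L : Ideal R // ∃ A : Set R, L = leftAnnihilator A} := by
  rw [wellFoundedGT_iff_monotone_chain_condition]
  intro a
  choose A hA using fun i => (a i).2
  obtain ⟨N, hN⟩ := h.acc_leftAnnihilator A (fun i j hij => by
    simp only [← hA]
    exact a.monotone hij)
  exact ⟨N, fun m hm => Subtype.ext (by rw [hA, hA, hN m hm])⟩

/-- In a semiprime ring with the ascending chain condition on left annihilators, a nonzero left
ideal is not nil. -/
theorem IsLeftGoldie.exists_not_isNilpotent (h : IsLeftGoldie R)
    (hR : ∀ b : R, (∀ r, b * r * b = 0) → b = 0) (I : Ideal R) (hI : I ≠ ⊥) :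
    ∃ a ∈ I, ¬ IsNilpotent a := by
  by_contra! hnil
  obtain ⟨a, haI, ha⟩ := Submodule.exists_mem_ne_zero_of_ne_bot hI
  have hnil' : ∀ r, IsNilpotent (a * r) := by
    intro r
    obtain ⟨k, hk⟩ := hnil (r * a) (I.mul_mem_left r haI)
    refine ⟨k + 1, ?_⟩
    have : ∀ k, (a * r) ^ (k + 1) = a * (r * a) ^ k * r := by
      intro k
      induction k with
      | zero => simp
      | succ k ih => rw [pow_succ, ih, pow_succ (r * a)]; noncomm_ring
    rw [this, hk, mul_zero, zero_mul]
  have hwf := h.wellFoundedGT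
  -- Choose a nonzero `u = a * r` with maximal left annihilator. Any nonzero `u * y` then has the
  -- same left annihilator, so `u * y * u ≠ 0` would make every power of `u * y` nonzero, although
  -- `u * y` is nilpotent.
  let T : Set {L : Ideal R // ∃ A : Set R, L = leftAnnihilator A} :=
    {L | ∃ r, a * r ≠ 0 ∧ L.1 = leftAnnihilator {a * r}}
  obtain ⟨⟨L, hL⟩, ⟨r, hr, hLr⟩, hmax⟩ := hwf.wf.has_min T
    ⟨⟨leftAnnihilator {a * 1}, _, rfl⟩, 1, by simpa using ha, rfl⟩
  set u := a * r with hu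
  have key : ∀ y b, u * y ≠ 0 → b * (u * y) = 0 → b * u = 0 := by
    intro y b hy hb
    have hle : L ≤ leftAnnihilator {u * y} := by
      simp only at hLr
      rw [hLr]
      intro c hc
      simp only [mem_leftAnnihilator, Set.mem_singleton_iff, forall_eq] at hc ⊢
      rw [← mul_assoc, hc, zero_mul]
    have hnot := hmax ⟨leftAnnihilator {u * y}, _, rfl⟩
      ⟨r * y, by rw [← mul_assoc]; exact hy, by rw [← mul_assoc]⟩
    have heq : L = leftAnnihilator {u * y} := by
      by_contra hne
      exact hnot (lt_of_le_of_ne hle fun h' => hne (congrArg Subtype.val h'))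
    have hbL : b ∈ L := by
      rw [heq]
      simpa [mem_leftAnnihilator] using hb
    simp only at hLr
    rw [hLr] at hbL
    simpa [mem_leftAnnihilator] using hbL
  refine hr (hR u fun y => ?_)
  by_contra hne
  have hn0 : u * y ≠ 0 := fun h0 => hne (by rw [h0, zero_mul])
  have hpow : ∀ k, (u * y) ^ (k + 1) ≠ 0 := by
    intro k
    induction k with
    | zero => simpa using hn0
    | succ k ih =>
      intro h0
      rw [pow_succ', pow_succ', mul_assoc u y ((u * y) ^ k)] at h0
      refine hne (key (y * (u * y) ^ k) (u * y) ?_ h0)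
      rw [← mul_assoc, ← pow_succ']
      exact ih
  obtain ⟨k, hk⟩ : IsNilpotent (u * y) := by
    rw [hu, mul_assoc]
    exact hnil' _
  exact hpow k (by rw [pow_succ, hk, zero_mul])

/-- A nonzero left ideal contains a nonzero element with the same left annihilator as its
square. -/
theorem IsLeftGoldie.exists_sq_annihilator (h : IsLeftGoldie R)
    (hR : ∀ b : R, (∀ r, b * r * b = 0) → b = 0) (I : Ideal R) (hI : I ≠ ⊥) :
    ∃ a ∈ I, a ≠ 0 ∧ ∀ b, b * (a * a) = 0 → b * a = 0 := by
  obtain ⟨a, haI, ha⟩ := h.exists_not_isNilpotent hR I hI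
  obtain ⟨N, hN⟩ := h.acc_leftAnnihilator (fun i => {a ^ i}) (monotone_nat_of_le_succ fun i b hb => by
    simp only [mem_leftAnnihilator, Set.mem_singleton_iff, forall_eq] at hb ⊢
    rw [pow_succ, ← mul_assoc, hb, zero_mul])
  -- The exponent is `N + 1` because `a ^ 0 = 1` need not lie in `I`.
  refine ⟨a ^ (N + 1), ?_, fun h0 => ha ⟨_, h0⟩, fun b hb => ?_⟩
  · rw [pow_succ]
    exact I.mul_mem_left _ haI
  · have h1 : b ∈ leftAnnihilator {a ^ (N + 1 + (N + 1))} := by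
      simpa [mem_leftAnnihilator, pow_add] using hb
    rw [hN _ (by omega), ← hN (N + 1) (by omega)] at h1
    simpa [mem_leftAnnihilator] using h1

/-- In a semiprime left Goldie ring, every left ideal `I` contains an element whose left
annihilator meets `I` trivially. -/
theorem IsLeftGoldie.exists_regular_mem (h : IsLeftGoldie R)
    (hR : ∀ b : R, (∀ r, b * r * b = 0) → b = 0) (I : Ideal R) :
    ∃ c ∈ I, ∀ b ∈ I, b * c = 0 → b = 0 := by
  by_contra! hcon
  -- If no such element exists, any `c ∈ I` with `ann(c²) = ann(c)` has a nonzero partner `α c ∈ I`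
  -- of the same kind with `α c * c = 0`. Iterating `c ↦ c + α c` from `0` will produce an infinite
  -- direct sum of left ideals.
  have step : ∀ c : {c : R // c ∈ I ∧ ∀ b, b * (c * c) = 0 → b * c = 0},
      ∃ a ∈ I, a ≠ 0 ∧ a * c.1 = 0 ∧ ∀ b, b * (a * a) = 0 → b * a = 0 := by
    rintro ⟨c, hcI, hc⟩
    obtain ⟨b, hbI, hbc, hb⟩ := hcon c hcI
    obtain ⟨a, ⟨haI, hac⟩, ha0, ha⟩ := h.exists_sq_annihilator hR (I ⊓ leftAnnihilator {c}) (by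
      intro hbot
      refine hb ((Submodule.mem_bot R).1 (hbot ▸ ⟨hbI, ?_⟩))
      intro x hx
      rw [Set.mem_singleton_iff.1 hx, hbc])
    exact ⟨a, haI, ha0, hac c rfl, ha⟩
  choose α hαI hα0 hαc hα using step
  have split : ∀ c : {c : R // c ∈ I ∧ ∀ b, b * (c * c) = 0 → b * c = 0}, ∀ b,
      b * (c.1 + α c) = 0 → b * c.1 = 0 ∧ b * α c = 0 := by
    intro c b hb
    have h1 : b * c.1 = 0 := by
      refine c.2.2 b ?_
      have := congrArg (· * c.1) hb
      simp only [zero_mul] at this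
      rwa [mul_assoc, add_mul, hαc, add_zero] at this
    refine ⟨h1, ?_⟩
    rwa [mul_add, h1, zero_add] at hb
  let next : {c : R // c ∈ I ∧ ∀ b, b * (c * c) = 0 → b * c = 0} →
      {c : R // c ∈ I ∧ ∀ b, b * (c * c) = 0 → b * c = 0} := fun c =>
    ⟨c.1 + α c, I.add_mem c.2.1 (hαI c), fun b hb => by
      rw [← mul_assoc] at hb
      obtain ⟨h1, h2⟩ := split c _ hb
      have h3 : b * c.1 = 0 := by
        refine c.2.2 b ?_
        rwa [mul_assoc, add_mul, hαc, add_zero] at h1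
      have h4 : b * α c = 0 := by
        refine hα c b ?_
        rwa [mul_assoc, add_mul, mul_add, ← mul_assoc b c.1, h3, zero_mul, zero_add] at h2
      rw [mul_add, h3, h4, add_zero]⟩
  let s : ℕ → {c : R // c ∈ I ∧ ∀ b, b * (c * c) = 0 → b * c = 0} := fun k =>
    next^[k] ⟨0, I.zero_mem, fun b _ => mul_zero b⟩
  have hs : ∀ k, (s (k + 1)).1 = (s k).1 + α (s k) := fun k => by
    simp only [s, Function.iterate_succ_apply', next]
  have hdown : ∀ i j b, b * (s (i + j)).1 = 0 → b * (s i).1 = 0 := by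
    intro i j b
    induction j with
    | zero => exact id
    | succ j ih =>
      intro hb
      rw [← add_assoc, hs] at hb
      exact ih (split _ _ hb).1
  have horth : ∀ i j, i < j → α (s j) * α (s i) = 0 := by
    intro i j hij
    obtain ⟨k, rfl⟩ := Nat.exists_eq_add_of_lt hij
    have h1 := hdown (i + 1) k (α (s (i + k + 1))) (by
      rw [show i + 1 + k = i + k + 1 by omega]
      exact hαc _)
    rw [hs] at h1
    exact (split _ _ h1).2
  refine h.no_infinite_direct_sum ⟨fun i => Ideal.span {α (s i)}, fun i => ?_, ?_⟩
  · simpa using hα0 (s i)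
  -- Multiply a relation on the right by `α (s i)`: terms with larger index die by `horth`, those
  -- with smaller index by induction, and `ann(α²) = ann(α)` removes the remaining one.
  · rw [iSupIndep_iff_finsetSum_eq_zero_imp_eq_zero]
    intro t v hv hsum i
    induction i using Nat.strong_induction_on with
    | _ i ih =>
      intro hi
      obtain ⟨r, hr⟩ := Ideal.mem_span_singleton'.1 (hv i hi)
      have h1 : v i * α (s i) = 0 := by
        have h2 := congrArg (· * α (s i)) hsum
        simp only [zero_mul, Finset.sum_mul] at h2
        rwa [Finset.sum_eq_single_of_mem i hi] at h2
        intro j hj hne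
        rcases lt_or_gt_of_ne hne with hlt | hlt
        · rw [ih j hlt hj, zero_mul]
        · obtain ⟨r', hr'⟩ := Ideal.mem_span_singleton'.1 (hv j hj)
          rw [← hr', mul_assoc, horth i j hlt, mul_zero]
      rw [← hr] at h1 ⊢
      exact hα _ _ (by rwa [← mul_assoc])

end Semiprime

/-! ### Coefficients and degree in a free skew extension -/

theorem skewVarEnd_single {R X : Type*} [Ring R] (σ : X → R →+* R) (δ : X → R →+ R) (x : X)
    (w : FreeMonoid X) (r : R) : skewVarEnd σ δ x (Finsupp.single w r) =
      Finsupp.single (FreeMonoid.of x * w) (σ x r) + Finsupp.single w (δ x r) :=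
  Finsupp.liftAddHom_apply_single _ w r

namespace IsFreeSkewExtension

variable {R X S : Type*} [Ring R] [Ring S] {σ : X → R →+* R} {δ : X → R →+ R} {ι : R →+* S}
  {v : X → S}

/-- The additive isomorphism `∑ r_w w ↦ ∑ r_w w` from finitely supported families of coefficients
to the free skew extension. -/
noncomputable def equiv (hS : IsFreeSkewExtension σ δ ι v) : (FreeMonoid X →₀ R) ≃+ S :=
  AddEquiv.ofBijective (Finsupp.liftAddHom fun w =>
    (AddMonoidHom.mulRight (FreeMonoid.lift v w)).comp ι.toAddMonoidHom) hS.basis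

/-- The coefficients of an element of the free skew extension. -/
noncomputable def coeff (hS : IsFreeSkewExtension σ δ ι v) : S →+ FreeMonoid X →₀ R :=
  hS.equiv.symm.toAddMonoidHom

theorem equiv_single (hS : IsFreeSkewExtension σ δ ι v) (w : FreeMonoid X) (r : R) :
    hS.equiv (Finsupp.single w r) = ι r * FreeMonoid.lift v w := by
  simp [equiv]

theorem coeff_equiv (hS : IsFreeSkewExtension σ δ ι v) (p : FreeMonoid X →₀ R) :
    hS.coeff (hS.equiv p) = p :=
  hS.equiv.symm_apply_apply p

theorem equiv_coeff (hS : IsFreeSkewExtension σ δ ι v) (s : S) : hS.equiv (hS.coeff s) = s :=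
  hS.equiv.apply_symm_apply s

theorem coeff_monomial (hS : IsFreeSkewExtension σ δ ι v) (w : FreeMonoid X) (r : R) :
    hS.coeff (ι r * FreeMonoid.lift v w) = Finsupp.single w r := by
  rw [← hS.equiv_single, coeff_equiv]

theorem coeff_ι (hS : IsFreeSkewExtension σ δ ι v) (r : R) :
    hS.coeff (ι r) = Finsupp.single 1 r := by
  simpa using hS.coeff_monomial 1 r

theorem coeff_one (hS : IsFreeSkewExtension σ δ ι v) : hS.coeff 1 = Finsupp.single 1 1 := by
  simpa using hS.coeff_ι 1

theorem coeff_v (hS : IsFreeSkewExtension σ δ ι v) (x : X) :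
    hS.coeff (v x) = Finsupp.single (FreeMonoid.of x) 1 := by
  simpa using hS.coeff_monomial (FreeMonoid.of x) 1

theorem coeff_injective (hS : IsFreeSkewExtension σ δ ι v) : Function.Injective hS.coeff :=
  hS.equiv.symm.injective

theorem eq_sum (hS : IsFreeSkewExtension σ δ ι v) (s : S) :
    s = (hS.coeff s).sum fun w r => ι r * FreeMonoid.lift v w :=
  (hS.equiv_coeff s).symm

/-- Additive induction on monomials. -/
theorem induction (hS : IsFreeSkewExtension σ δ ι v) {p : S → Prop} (zero : p 0)
    (add : ∀ s t, p s → p t → p (s + t))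
    (monomial : ∀ r w, p (ι r * FreeMonoid.lift v w)) (s : S) : p s := by
  rw [← hS.equiv_coeff s]
  induction hS.coeff s using Finsupp.induction_linear with
  | zero => rwa [map_zero]
  | add f g hf hg =>
    rw [map_add]
    exact add _ _ hf hg
  | single w r =>
    rw [equiv_single]
    exact monomial r w

theorem coeff_ι_mul (hS : IsFreeSkewExtension σ δ ι v) (r : R) (s : S) (w : FreeMonoid X) :
    hS.coeff (ι r * s) w = r * hS.coeff s w := by
  induction s using hS.induction with
  | zero => simp
  | add s t h1 h2 => rw [mul_add, map_add, map_add, Finsupp.add_apply, Finsupp.add_apply, h1, h2,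
      mul_add]
  | monomial a z =>
    classical
    rw [← mul_assoc, ← map_mul, coeff_monomial, coeff_monomial, Finsupp.single_apply,
      Finsupp.single_apply]
    split_ifs <;> simp

theorem coeff_v_mul (hS : IsFreeSkewExtension σ δ ι v) (x : X) (s : S) :
    hS.coeff (v x * s) = skewVarEnd σ δ x (hS.coeff s) := by
  induction s using hS.induction with
  | zero => simp
  | add s t h1 h2 => rw [mul_add, map_add, map_add, map_add, h1, h2]
  | monomial a z =>
    rw [← mul_assoc, hS.commutation, add_mul, map_add, mul_assoc, ← FreeMonoid.lift_eval_of v x,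
      ← map_mul, coeff_monomial, coeff_monomial, coeff_monomial, skewVarEnd_single]

/-- The elements all of whose coefficients at words of length greater than `m` vanish. -/
def DegLE (hS : IsFreeSkewExtension σ δ ι v) (m : ℕ) (s : S) : Prop :=
  ∀ w : FreeMonoid X, m < w.length → hS.coeff s w = 0

theorem DegLE.add {hS : IsFreeSkewExtension σ δ ι v} {m : ℕ} {s t : S} (h : hS.DegLE m s)
    (h' : hS.DegLE m t) : hS.DegLE m (s + t) := fun w hw => by
  rw [map_add, Finsupp.add_apply, h w hw, h' w hw, add_zero]

theorem DegLE.ι_mul {hS : IsFreeSkewExtension σ δ ι v} {m : ℕ} {s : S} (h : hS.DegLE m s)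
    (r : R) : hS.DegLE m (ι r * s) := fun w hw => by
  rw [coeff_ι_mul, h w hw, mul_zero]

theorem degLE_ι (hS : IsFreeSkewExtension σ δ ι v) (r : R) : hS.DegLE 0 (ι r) := fun w hw => by
  classical
  rw [coeff_ι, Finsupp.single_apply, if_neg]
  rintro rfl
  simp at hw

theorem degLE_v (hS : IsFreeSkewExtension σ δ ι v) (x : X) : hS.DegLE 1 (v x) := fun w hw => by
  classical
  rw [coeff_v, Finsupp.single_apply, if_neg]
  rintro rfl
  simp at hw

theorem coeff_v_mul_apply (hS : IsFreeSkewExtension σ δ ι v) (x : X) (s : S) (y : X)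
    (w : FreeMonoid X) [Decidable (y = x)] :
    hS.coeff (v x * s) (FreeMonoid.of y * w) =
      (if y = x then σ x (hS.coeff s w) else 0) + δ x (hS.coeff s (FreeMonoid.of y * w)) := by
  rw [coeff_v_mul]
  induction hS.coeff s using Finsupp.induction_linear with
  | zero => simp
  | add f g hf hg =>
    rw [map_add, Finsupp.add_apply, hf, hg, Finsupp.add_apply, Finsupp.add_apply, map_add, map_add]
    split_ifs <;> abel
  | single z r =>
    classical
    have : FreeMonoid.of x * z = FreeMonoid.of y * w ↔ x = y ∧ z = w := List.cons_eq_cons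
    simp only [skewVarEnd_single, Finsupp.add_apply, Finsupp.single_apply, this]
    by_cases h1 : x = y <;> by_cases h2 : z = w <;> by_cases h3 : z = FreeMonoid.of y * w <;>
      simp [h1, h2, h3, eq_comm]

-- Moving a variable past a coefficient lengthens the word only in the `σ`-term. The `δ`-terms
-- therefore never reach the top degree, where multiplication by `u` just prefixes `u` and twists
-- the coefficient.
open scoped Classical in
theorem DegLE.word_mul {hS : IsFreeSkewExtension σ δ ι v} {m : ℕ} {f : S} (hf : hS.DegLE m f)
    (u : FreeMonoid X) : hS.DegLE (u.length + m) (FreeMonoid.lift v u * f) ∧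
      ∀ u' w : FreeMonoid X, u'.length = u.length → w.length = m →
        hS.coeff (FreeMonoid.lift v u * f) (u' * w) =
          if u' = u then FreeMonoid.lift σ u (hS.coeff f w) else 0 := by
  induction u using FreeMonoid.inductionOn' with
  | one =>
    refine ⟨by simpa using hf, fun u' w hu' _ => ?_⟩
    rw [FreeMonoid.length_one, FreeMonoid.length_eq_zero] at hu'
    simp [hu']
  | of_mul x u ih =>
    obtain ⟨ih1, ih2⟩ := ih
    rw [map_mul (FreeMonoid.lift v), map_mul (FreeMonoid.lift σ), FreeMonoid.lift_eval_of,
      FreeMonoid.lift_eval_of, mul_assoc,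
      FreeMonoid.length_mul, FreeMonoid.length_of]
    constructor
    · intro z hz
      induction z using FreeMonoid.casesOn with
      | one => simp at hz
      | of_mul y z =>
        rw [FreeMonoid.length_mul, FreeMonoid.length_of] at hz
        rw [coeff_v_mul_apply, ih1 z (by omega), ih1 (FreeMonoid.of y * z) (by
          rw [FreeMonoid.length_mul, FreeMonoid.length_of]; omega)]
        simp
    · intro u' w hu' hw
      induction u' using FreeMonoid.casesOn with
      | one =>
        rw [FreeMonoid.length_one] at hu'
        omega
      | of_mul y z =>
        rw [FreeMonoid.length_mul, FreeMonoid.length_of] at hu'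
        have heq : FreeMonoid.of y * z = FreeMonoid.of x * u ↔ y = x ∧ z = u := List.cons_eq_cons
        rw [mul_assoc, coeff_v_mul_apply, ih2 z w (by omega) hw, ← mul_assoc,
          ih1 (FreeMonoid.of y * z * w) (by
            rw [FreeMonoid.length_mul, FreeMonoid.length_mul, FreeMonoid.length_of]; omega),
          map_zero, add_zero]
        simp only [heq]
        by_cases h1 : y = x <;> by_cases h2 : z = u <;> simp [h1, h2]

theorem coeff_mul (hS : IsFreeSkewExtension σ δ ι v) (g f : S) (z : FreeMonoid X) :
    hS.coeff (g * f) z =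
      (hS.coeff g).sum fun u b => b * hS.coeff (FreeMonoid.lift v u * f) z := by
  conv_lhs => rw [hS.eq_sum g]
  simp only [Finsupp.sum, Finset.sum_mul, map_sum, Finsupp.finsetSum_apply, mul_assoc, coeff_ι_mul]

theorem DegLE.mul {hS : IsFreeSkewExtension σ δ ι v} {k m : ℕ} {g f : S} (hg : hS.DegLE k g)
    (hf : hS.DegLE m f) : hS.DegLE (k + m) (g * f) := by
  intro z hz
  rw [coeff_mul]
  refine Finset.sum_eq_zero fun u hu => ?_
  have : u.length ≤ k := by
    by_contra! h
    exact Finsupp.mem_support_iff.1 hu (hg u h)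
  dsimp only
  rw [(hf.word_mul u).1 z (by omega), mul_zero]

/-- The coefficients of top degree of a product. -/
theorem DegLE.coeff_mul {hS : IsFreeSkewExtension σ δ ι v} {k m : ℕ} {g f : S}
    (hg : hS.DegLE k g) (hf : hS.DegLE m f) {u w : FreeMonoid X} (hu : u.length = k)
    (hw : w.length = m) :
    hS.coeff (g * f) (u * w) = hS.coeff g u * FreeMonoid.lift σ u (hS.coeff f w) := by
  classical
  rw [IsFreeSkewExtension.coeff_mul, Finsupp.sum, Finset.sum_eq_single u]
  · rw [(hf.word_mul u).2 u w rfl hw, if_pos rfl]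
  · intro u' hu' hne
    have : u'.length ≤ k := by
      by_contra! h
      exact Finsupp.mem_support_iff.1 hu' (hg u' h)
    rcases this.lt_or_eq with h | h
    · rw [(hf.word_mul u').1 (u * w) (by rw [FreeMonoid.length_mul]; omega), mul_zero]
    · rw [(hf.word_mul u').2 u w (by omega) hw, if_neg hne.symm, mul_zero]
  · intro h
    rw [Finsupp.notMem_support_iff.1 h, zero_mul]

end IsFreeSkewExtension

theorem FreeMonoid.eq_of_length_eq {X : Type*} [Subsingleton X] {u w : FreeMonoid X}
    (h : u.length = w.length) : u = w :=
  List.ext_getElem h fun _ _ _ => Subsingleton.elim _ _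

/-! ### Annihilators of ideals in semiprime left Goldie rings -/

section Semiprime

variable {R : Type*} [Ring R]

/-- In a semiprime ring, the left and right annihilators of a two-sided ideal agree. -/
theorem forall_mul_eq_zero_comm (hR : ∀ b : R, (∀ r, b * r * b = 0) → b = 0) {C : Set R}
    (hl : ∀ r, ∀ c ∈ C, r * c ∈ C) (hr : ∀ r, ∀ c ∈ C, c * r ∈ C) (a : R) :
    (∀ c ∈ C, a * c = 0) ↔ ∀ c ∈ C, c * a = 0 := by
  constructor
  · intro h c hc
    refine hR _ fun r => ?_
    rw [show c * a * r * (c * a) = c * (a * (r * c)) * a by noncomm_ring, h _ (hl r c hc), mul_zero,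
      zero_mul]
  · intro h c hc
    refine hR _ fun r => ?_
    rw [show a * c * r * (a * c) = a * (c * r * a) * c by noncomm_ring, h _ (hr r c hc), mul_zero,
      zero_mul]

/-- In a semiprime ring with the ascending chain condition on left annihilators, the left
annihilators of an ascending chain of two-sided ideals become stationary. -/
theorem IsLeftGoldie.exists_leftAnnihilator_eq (h : IsLeftGoldie R)
    (hR : ∀ b : R, (∀ r, b * r * b = 0) → b = 0) {C : ℕ → Set R} (hC : Monotone C)
    (hl : ∀ m r, ∀ c ∈ C m, r * c ∈ C m) (hr : ∀ m r, ∀ c ∈ C m, c * r ∈ C m) :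
    ∃ N, ∀ m, N ≤ m → leftAnnihilator (C m) = leftAnnihilator (C N) := by
  -- The annihilators of the `C m` descend, so the chain condition is applied to their double
  -- annihilators, which ascend. Semiprimeness identifies left and right annihilators, which
  -- recovers the single annihilator from the double one.
  obtain ⟨N, hN⟩ := h.acc_leftAnnihilator (fun m => (leftAnnihilator (C m) : Set R))
    (monotone_nat_of_le_succ fun m b hb a ha => hb a fun c hc => ha c (hC m.le_succ hc))
  refine ⟨N, fun m hm => le_antisymm (fun a ha c hc => ha c (hC hm hc)) fun a ha => ?_⟩
  rw [mem_leftAnnihilator, forall_mul_eq_zero_comm hR (hl m) (hr m)]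
  intro c hc
  have h1 : c ∈ leftAnnihilator (leftAnnihilator (C m) : Set R) := fun b hb =>
    (forall_mul_eq_zero_comm hR (hl m) (hr m) b).1 hb c hc
  rw [hN m hm] at h1
  exact h1 a ha

/-- An automorphism mapping the preimage of a left annihilator into itself preserves it. -/
theorem IsLeftGoldie.apply_mem_leftAnnihilator (h : IsLeftGoldie R) {σ : R →+* R}
    (hσ : Function.Bijective σ) {C : Set R}
    (hC : ∀ a, σ a ∈ leftAnnihilator C → a ∈ leftAnnihilator C) {a : R}
    (ha : a ∈ leftAnnihilator C) : σ a ∈ leftAnnihilator C := by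
  have hmem : ∀ i b, σ^[i] b ∈ leftAnnihilator (σ^[i] '' C) ↔ b ∈ leftAnnihilator C := by
    intro i b
    simp only [mem_leftAnnihilator, Set.forall_mem_image, ← iterate_map_mul]
    refine forall₂_congr fun c _ => ?_
    exact (hσ.injective.iterate i).eq_iff' (iterate_map_zero σ i)
  -- With `L` the annihilator of `C`, the hypothesis says `L ⊆ σ(L)`. The chain `L ⊆ σ(L) ⊆ σ²(L) ⊆
  -- ⋯` consists of left annihilators, and undoing `σ^N` where it stops gives `σ(L) = L`.
  obtain ⟨N, hN⟩ := h.acc_leftAnnihilator (fun i => σ^[i] '' C)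
    (monotone_nat_of_le_succ fun i b hb => by
      obtain ⟨b, rfl⟩ := hσ.surjective.iterate (i + 1) b
      refine (hmem (i + 1) b).2 (hC b ?_)
      rw [Function.iterate_succ_apply] at hb
      exact (hmem i _).1 hb)
  have h1 := (hmem (N + 1) a).2 ha
  rw [hN (N + 1) N.le_succ, Function.iterate_succ_apply] at h1
  exact (hmem N _).1 h1

end Semiprime

/-! ### Top coefficients of ideals, and vanishing of the Jacobson radical -/

namespace IsFreeSkewExtension

variable {R X S : Type*} [Ring R] [Ring S] {σ : X → R →+* R} {δ : X → R →+ R} {ι : R →+* S}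
  {v : X → S}

theorem lift_bijective {σ : X → R →+* R} (hσ : ∀ x, Function.Bijective (σ x)) (u : FreeMonoid X) :
    Function.Bijective (FreeMonoid.lift σ u) := by
  induction u using FreeMonoid.inductionOn' with
  | one => simpa using Function.bijective_id
  | of_mul x u ih =>
    rw [map_mul, FreeMonoid.lift_eval_of]
    exact (hσ x).comp ih

/-- The coefficients at words of length `m` of the elements of degree at most `m` of `J`. -/
def topCoeffs (hS : IsFreeSkewExtension σ δ ι v) (J : Ideal S) (m : ℕ) : Set R :=
  {c | ∃ f ∈ J, hS.DegLE m f ∧ ∃ w : FreeMonoid X, w.length = m ∧ hS.coeff f w = c}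

theorem mul_mem_topCoeffs (hS : IsFreeSkewExtension σ δ ι v) (J : Ideal S) (m : ℕ) (r : R) (c : R) (hc : c ∈ hS.topCoeffs J m) :
    r * c ∈ hS.topCoeffs J m := by
  obtain ⟨f, hf, hm, w, hw, rfl⟩ := hc
  exact ⟨ι r * f, J.mul_mem_left _ hf, hm.ι_mul r, w, hw, hS.coeff_ι_mul _ _ _⟩

theorem topCoeffs_mul_mem (hS : IsFreeSkewExtension σ δ ι v) (J : Ideal S) [J.IsTwoSided] (hσ : ∀ x, Function.Bijective (σ x)) (m : ℕ) (r : R)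
    (c : R) (hc : c ∈ hS.topCoeffs J m) : c * r ∈ hS.topCoeffs J m := by
  obtain ⟨f, hf, hm, w, hw, rfl⟩ := hc
  -- Right multiplication by a scalar reaches the coefficient at `w` twisted by `σ_w`, so the scalar
  -- is first pulled back along `σ_w`.
  obtain ⟨r, rfl⟩ := (lift_bijective hσ w).2 r
  refine ⟨f * ι r, J.mul_mem_right _ hf, hm.mul (hS.degLE_ι r), w, hw, ?_⟩
  have := hm.coeff_mul (hS.degLE_ι r) hw FreeMonoid.length_one
  simpa [coeff_ι] using this

theorem DegLE.coeff_mul_v {hS : IsFreeSkewExtension σ δ ι v} {m : ℕ} {f : S} (hf : hS.DegLE m f)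
    {w : FreeMonoid X} (hw : w.length = m) (x y : X) [Decidable (x = y)] :
    hS.coeff (f * v x) (w * FreeMonoid.of y) = if x = y then hS.coeff f w else 0 := by
  classical
  rw [hf.coeff_mul (hS.degLE_v x) hw (FreeMonoid.length_of y), coeff_v, Finsupp.single_apply]
  simp only [FreeMonoid.of_injective.eq_iff]
  split_ifs <;> simp

theorem topCoeffs_mono (hS : IsFreeSkewExtension σ δ ι v) (J : Ideal S) [Nonempty X] [J.IsTwoSided] : Monotone (hS.topCoeffs J) := by
  classical
  refine monotone_nat_of_le_succ ?_
  rintro m _ ⟨f, hf, hm, w, hw, rfl⟩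
  obtain ⟨x⟩ := ‹Nonempty X›
  exact ⟨f * v x, J.mul_mem_right _ hf, hm.mul (hS.degLE_v x), w * FreeMonoid.of x,
    by rw [FreeMonoid.length_mul, FreeMonoid.length_of, hw], by rw [hm.coeff_mul_v hw, if_pos rfl]⟩

theorem apply_mem_topCoeffs (hS : IsFreeSkewExtension σ δ ι v) (J : Ideal S) {m : ℕ} {c : R} (hc : c ∈ hS.topCoeffs J m) (x : X) :
    σ x c ∈ hS.topCoeffs J (m + 1) := by
  obtain ⟨f, hf, hm, w, hw, rfl⟩ := hc
  refine ⟨v x * f, J.mul_mem_left _ hf, add_comm 1 m ▸ (hS.degLE_v x).mul hm,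
    FreeMonoid.of x * w, by rw [FreeMonoid.length_mul, FreeMonoid.length_of, hw, add_comm], ?_⟩
  rw [(hS.degLE_v x).coeff_mul hm (FreeMonoid.length_of x) hw, coeff_v]
  simp

/-- Every left combination `c` of top coefficients of elements of `J` is controlled by the top
coefficients of a single element of `J`. -/
theorem exists_mem_of_mem_span_topCoeffs (hS : IsFreeSkewExtension σ δ ι v) (J : Ideal S) [Nonempty X] [J.IsTwoSided] (m : ℕ) (c : R)
    (hc : c ∈ Ideal.span (hS.topCoeffs J m)) :
    ∃ k, m ≤ k ∧ ∃ f ∈ J, hS.DegLE k f ∧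
      ∀ b, (∀ w : FreeMonoid X, w.length = k → b * hS.coeff f w = 0) → b * c = 0 := by
  classical
  have mem : ∀ c ∈ hS.topCoeffs J m, ∃ k, m ≤ k ∧ ∃ f ∈ J, hS.DegLE k f ∧
      ∀ b, (∀ w : FreeMonoid X, w.length = k → b * hS.coeff f w = 0) → b * c = 0 := by
    rintro _ ⟨f, hf, hm, w, hw, rfl⟩
    exact ⟨m, le_rfl, f, hf, hm, fun b hb => hb w hw⟩
  -- With one variable there is a single word of each length, so the top coefficients are already
  -- closed under addition. With two variables `x ≠ y`, the elements `f` and `g` are brought to the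
  -- same degree and `f * v x + g * v y` keeps their top coefficients at different words.
  rcases subsingleton_or_nontrivial X with hX | hX
  · refine mem c ?_
    induction hc using Submodule.span_induction with
    | mem c hc => exact hc
    | zero =>
      obtain ⟨x⟩ := ‹Nonempty X›
      exact ⟨0, J.zero_mem, fun w _ => by simp, FreeMonoid.ofList (List.replicate m x),
        List.length_replicate, by simp⟩
    | add c d _ _ h1 h2 =>
      obtain ⟨f, hf, hm, w, hw, rfl⟩ := h1
      obtain ⟨g, hg, hm', w', hw', rfl⟩ := h2
      obtain rfl : w = w' := FreeMonoid.eq_of_length_eq (hw.trans hw'.symm)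
      exact ⟨f + g, J.add_mem hf hg, hm.add hm', w, hw, by rw [map_add, Finsupp.add_apply]⟩
    | smul r c _ h1 => exact hS.mul_mem_topCoeffs J m r c h1
  · obtain ⟨x, y, hxy⟩ := exists_pair_ne X
    have raise : ∀ j k c, (∃ f ∈ J, hS.DegLE k f ∧
        ∀ b, (∀ w : FreeMonoid X, w.length = k → b * hS.coeff f w = 0) → b * c = 0) →
        (∃ f ∈ J, hS.DegLE (k + j) f ∧
        ∀ b, (∀ w : FreeMonoid X, w.length = k + j → b * hS.coeff f w = 0) → b * c = 0) := by
      intro j k c h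
      induction j with
      | zero => exact h
      | succ j ih =>
        obtain ⟨f, hf, hk, hb⟩ := ih
        refine ⟨f * v x, J.mul_mem_right _ hf, hk.mul (hS.degLE_v x), fun b h => hb b ?_⟩
        intro w hw
        have := h (w * FreeMonoid.of x) (by
          rw [FreeMonoid.length_mul, FreeMonoid.length_of, hw]; rfl)
        rwa [hk.coeff_mul_v hw, if_pos rfl] at this
    induction hc using Submodule.span_induction with
    | mem c hc => exact mem c hc
    | zero => exact ⟨m, le_rfl, 0, J.zero_mem, fun w _ => by simp, fun b _ => mul_zero b⟩
    | add c d _ _ h1 h2 =>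
      obtain ⟨k, hk, h1⟩ := h1
      obtain ⟨l, hl, h2⟩ := h2
      obtain ⟨f, hf, hfd, hfb⟩ := raise l k c h1
      obtain ⟨g, hg, hgd, hgb⟩ := raise k l d h2
      rw [add_comm l k] at hgd hgb
      refine ⟨k + l + 1, by omega, f * v x + g * v y,
        J.add_mem (J.mul_mem_right _ hf) (J.mul_mem_right _ hg),
        (hfd.mul (hS.degLE_v x)).add (hgd.mul (hS.degLE_v y)), fun b h => ?_⟩
      rw [mul_add, hfb b, hgb b, add_zero]
      · intro w hw
        have := h (w * FreeMonoid.of y) (by rw [FreeMonoid.length_mul, FreeMonoid.length_of, hw])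
        rwa [map_add, Finsupp.add_apply, hfd.coeff_mul_v hw, hgd.coeff_mul_v hw, if_neg hxy,
          if_pos rfl, zero_add] at this
      · intro w hw
        have := h (w * FreeMonoid.of x) (by rw [FreeMonoid.length_mul, FreeMonoid.length_of, hw])
        rwa [map_add, Finsupp.add_apply, hfd.coeff_mul_v hw, hgd.coeff_mul_v hw, if_neg hxy.symm,
          if_pos rfl, add_zero] at this
    | smul r c _ h1 =>
      obtain ⟨k, hk, f, hf, hfd, hfb⟩ := h1
      refine ⟨k, hk, ι r * f, J.mul_mem_left _ hf, hfd.ι_mul r, fun b h => ?_⟩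
      rw [smul_eq_mul, ← mul_assoc]
      refine hfb _ fun w hw => ?_
      rw [mul_assoc, ← coeff_ι_mul hS]
      exact h w hw

/-- If `Q` is stable under the `σ_x⁻¹` and `δ_x`, and `Q c = 0`, then `Q w c = 0` for every
word `w`. -/
theorem ι_mul_word_mul_ι_eq_zero (hS : IsFreeSkewExtension σ δ ι v) {Q : Set R} (hQσ : ∀ x, ∀ a ∈ Q, ∃ b ∈ Q, σ x b = a)
    (hQδ : ∀ x, ∀ a ∈ Q, δ x a ∈ Q) {c : R} (hc : ∀ a ∈ Q, a * c = 0) (w : FreeMonoid X) :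
    ∀ a ∈ Q, ι a * FreeMonoid.lift v w * ι c = 0 := by
  induction w using FreeMonoid.inductionOn' with
  | one =>
    intro a ha
    rw [map_one, mul_one, ← map_mul, hc a ha, map_zero]
  | of_mul x w ih =>
    intro a ha
    obtain ⟨b, hb, rfl⟩ := hQσ x a ha
    -- Read from right to left, the commutation rule carries a coefficient to the right past `x`, at
    -- the price of `σ x` inverse and of `δ x`; both stay in `Q`.
    have h1 : ι (σ x b) * v x = v x * ι b - ι (δ x b) := by
      rw [hS.commutation, add_sub_cancel_right]
    rw [map_mul, FreeMonoid.lift_eval_of, ← mul_assoc, h1, sub_mul, sub_mul, ih _ (hQδ x b hb),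
      mul_assoc, mul_assoc, ← mul_assoc (ι b), ih b hb, mul_zero, sub_zero]

/-- The free skew extension, with automorphisms, of a semiprime left Goldie ring has zero Jacobson
radical. -/
theorem jacobson_eq_bot (hS : IsFreeSkewExtension σ δ ι v) [Nonempty X] (hG : IsLeftGoldie R)
    (hR : ∀ b : R, (∀ r, b * r * b = 0) → b = 0) (hσ : ∀ x, Function.Bijective (σ x))
    (hδ : ∀ x, IsSkewDerivation (σ x) (δ x)) : Ring.jacobson S = ⊥ := by
  by_contra hJ
  set J := Ring.jacobson S with hJdef
  obtain ⟨f₀, hf₀, hne⟩ := Submodule.exists_mem_ne_zero_of_ne_bot hJ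
  have hl := hS.mul_mem_topCoeffs J
  have hr := hS.topCoeffs_mul_mem J hσ
  have hmono := hS.topCoeffs_mono J
  obtain ⟨m₀, c₀, hc₀, hc₀ne⟩ : ∃ m₀, ∃ c ∈ hS.topCoeffs J m₀, c ≠ 0 := by
    have hsupp : (hS.coeff f₀).support.Nonempty := by
      rw [Finsupp.support_nonempty_iff]
      intro h0
      exact hne (hS.coeff_injective (h0.trans (map_zero _).symm))
    obtain ⟨w, hw, hmax⟩ := Finset.exists_max_image _ FreeMonoid.length hsupp
    refine ⟨w.length, _, ⟨f₀, hf₀, fun z hz => ?_, w, rfl, rfl⟩, Finsupp.mem_support_iff.1 hw⟩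
    by_contra h0
    exact hz.not_ge (hmax z (Finsupp.mem_support_iff.2 h0))
  obtain ⟨N, hN⟩ := hG.exists_leftAnnihilator_eq hR hmono hl hr
  -- Here `M ≥ N` makes the annihilator stationary, `M ≥ m₀` puts the nonzero `c₀` among the top
  -- coefficients, and `M > 0` lets top degrees of products exceed those of the constant `1` and of
  -- `z₂`.
  set M := N + m₀ + 1 with hM
  set C := hS.topCoeffs J M with hC
  set Q := leftAnnihilator C with hQ
  have hQm : ∀ m, M ≤ m → leftAnnihilator (hS.topCoeffs J m) = Q := fun m hm => by
    rw [hQ, hC, hN m (by omega), hN M (by omega)]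
  have hQσ' : ∀ x a, σ x a ∈ Q → a ∈ Q := by
    intro x a ha c hc
    rw [← hQm (M + 1) (by omega)] at ha
    apply (hσ x).1
    rw [map_mul, map_zero]
    exact ha _ (hS.apply_mem_topCoeffs J hc x)
  have hQσ : ∀ x a, a ∈ Q → σ x a ∈ Q := fun x a ha =>
    hG.apply_mem_leftAnnihilator (hσ x) (hQσ' x) ha
  have hQδ : ∀ x, ∀ a ∈ Q, δ x a ∈ Q := by
    intro x a ha c hc
    -- With `d = δ x a * c`, expand `0 = δ x (a c r d)`: every term except `d r d` vanishes because
    -- `σ x a ∈ Q` and `a c = 0`.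
    refine hR _ fun r => ?_
    set d := δ x a * c
    have hd : r * d ∈ C := hl M _ _ (hl M _ _ hc)
    have h1 := hδ x a (c * (r * d))
    rw [← mul_assoc a, ha c hc, zero_mul, map_zero, hδ x c (r * d), mul_add, ← mul_assoc (σ x a),
      ← mul_assoc (σ x a)] at h1
    have h2 : σ x a * δ x c * (r * d) = 0 := by
      rw [mul_assoc]
      exact hQσ x a ha _ (hl M _ _ hd)
    have h3 : σ x a * σ x c = 0 := by rw [← map_mul, ha c hc, map_zero]
    rw [h2, h3, zero_mul, add_zero, add_zero, ← mul_assoc, ← mul_assoc] at h1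
    exact h1.symm
  have hQu : ∀ u a, FreeMonoid.lift σ u a ∈ Q ↔ a ∈ Q := by
    intro u
    induction u using FreeMonoid.inductionOn' with
    | one => intro a; simp
    | of_mul x u ih =>
      intro a
      rw [map_mul, FreeMonoid.lift_eval_of, ← ih a]
      exact ⟨hQσ' x _, hQσ x _⟩
  set I := Ideal.span C with hI
  have hQI : ∀ i ∈ I, ∀ a ∈ Q, a * i = 0 := by
    intro i hi
    induction hi using Submodule.span_induction with
    | mem c hc => exact fun a ha => ha c hc
    | zero => exact fun a _ => mul_zero a
    | add c d _ _ h1 h2 => exact fun a ha => by rw [mul_add, h1 a ha, h2 a ha, add_zero]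
    | smul r c _ h1 =>
      intro a ha
      rw [smul_eq_mul, ← mul_assoc]
      exact h1 _ fun c hc => by rw [mul_assoc]; exact ha _ (hl M _ _ hc)
  have hIr : ∀ i ∈ I, ∀ r, i * r ∈ I := by
    intro i hi r
    induction hi using Submodule.span_induction with
    | mem c hc => exact Ideal.subset_span (hr M r c hc)
    | zero => rw [zero_mul]; exact I.zero_mem
    | add c d _ _ h1 h2 => rw [add_mul]; exact I.add_mem h1 h2
    | smul s c _ h1 => rw [smul_eq_mul, mul_assoc]; exact I.mul_mem_left s h1
  have hQI0 : ∀ y ∈ Q, y ∈ I → y = 0 := fun y hyQ hyI => hR y fun r => by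
    rw [mul_assoc]
    exact hQI _ (I.mul_mem_left r hyI) y hyQ
  obtain ⟨c, hcI, hcreg⟩ := hG.exists_regular_mem hR I
  have hcQ : ∀ b, b * c = 0 → b ∈ Q := by
    intro b hb i hi
    refine hR _ fun r => ?_
    have h1 : i * r * b = 0 := hcreg _ (by
        rw [mul_assoc]; exact hIr i (Ideal.subset_span hi) _) (by rw [mul_assoc, hb, mul_zero])
    rw [show b * i * r * (b * i) = b * (i * r * b) * i by noncomm_ring, h1, mul_zero, zero_mul]
  obtain ⟨m, hMm, f, hfJ, hfm, hfc⟩ := hS.exists_mem_of_mem_span_topCoeffs J M c hcI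
  obtain ⟨z, hz⟩ : ∃ z, z * ι c * f + z = 1 := by
    rw [hJdef, ← Ideal.jacobson_bot, Ideal.mem_jacobson_iff] at hfJ
    obtain ⟨z, hz⟩ := hfJ (ι c)
    exact ⟨z, sub_eq_zero.1 hz⟩
  classical
  -- Split `z` by whether its coefficients lie in `Q`. Stability of `Q` gives `z₁ c = 0`, so only
  -- `z₂`, whose nonzero coefficients avoid `Q`, meets `c f`.
  let z₁ := hS.equiv ((hS.coeff z).filter fun w => hS.coeff z w ∈ Q)
  let z₂ := hS.equiv ((hS.coeff z).filter fun w => ¬ hS.coeff z w ∈ Q)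
  have hz12 : z = z₁ + z₂ := by
    rw [← map_add, Finsupp.filter_add_filter_not, equiv_coeff]
  have hz₁ : ∀ w, hS.coeff z₁ w ∈ Q := by
    intro w
    rw [coeff_equiv, Finsupp.filter_apply]
    split_ifs with h
    exacts [h, Q.zero_mem]
  have hz₂ : ∀ w, hS.coeff z₂ w ∈ Q → hS.coeff z₂ w = 0 := by
    intro w
    rw [coeff_equiv, Finsupp.filter_apply]
    split_ifs with h
    exacts [fun _ => rfl, fun h' => absurd h' h]
  have hz₁c : z₁ * ι c = 0 := by
    rw [hS.eq_sum z₁, Finsupp.sum, Finset.sum_mul]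
    refine Finset.sum_eq_zero fun w _ => hS.ι_mul_word_mul_ι_eq_zero (Q := Q) ?_ hQδ (hQI c hcI) w _
      (hz₁ w)
    intro x a ha
    obtain ⟨b, rfl⟩ := (hσ x).2 a
    exact ⟨b, hQσ' x b ha, rfl⟩
  have hz' : z₂ * (ι c * f) + z₁ + z₂ = 1 := by
    rw [← hz, hz12, add_mul, hz₁c, zero_add, mul_assoc, add_assoc]
  by_cases h0 : z₂ = 0
  · rw [h0, zero_mul, zero_add, add_zero] at hz'
    have h1 := hz₁ 1
    rw [hz', coeff_one, Finsupp.single_eq_same] at h1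
    have := h1 c₀ (hmono (by omega) hc₀)
    rw [one_mul] at this
    exact hc₀ne this
  · have hsupp : (hS.coeff z₂).support.Nonempty := by
      rw [Finsupp.support_nonempty_iff]
      intro h
      exact h0 (hS.coeff_injective (h.trans (map_zero _).symm))
    obtain ⟨u, hu, hmax⟩ := Finset.exists_max_image _ FreeMonoid.length hsupp
    have hdeg : hS.DegLE u.length z₂ := by
      intro w hw
      by_contra h
      exact hw.not_ge (hmax w (Finsupp.mem_support_iff.2 h))
    refine Finsupp.mem_support_iff.1 hu (hz₂ u ?_)
    obtain ⟨b, hb⟩ := (lift_bijective hσ u).2 (hS.coeff z₂ u)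
    -- At the word `u w` only the top part of `z₂ c f` and a coefficient of `z₁` survive. Hence `b *
    -- c * f_w` lies in `Q` as well as in `I`, and these meet trivially.
    have key : ∀ w : FreeMonoid X, w.length = m → b * c * hS.coeff f w = 0 := by
      intro w hw
      have h1 := congrArg (fun s => hS.coeff s (u * w)) hz'
      simp only [map_add, Finsupp.add_apply] at h1
      have hlen : (u * w).length = u.length + m := by rw [FreeMonoid.length_mul, hw]
      rw [hdeg (u * w) (by omega), add_zero, coeff_one, Finsupp.single_apply, if_neg (by
        intro h; rw [← h, FreeMonoid.length_one] at hlen; omega),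
        hdeg.coeff_mul (hfm.ι_mul c) rfl hw, coeff_ι_mul, ← hb, ← map_mul, ← mul_assoc] at h1
      refine hQI0 _ ?_ ?_
      · rw [← hQu u, eq_neg_of_add_eq_zero_left h1]
        exact Q.neg_mem (hz₁ _)
      · exact hIr _ (I.mul_mem_left b hcI) _
    rw [← hb, hQu]
    exact hcQ b (hcreg _ (I.mul_mem_left b hcI) (hfc _ key))

end IsFreeSkewExtension

/-! ### The prime radical under automorphisms -/

section PrimeRadical

/-- The prime radical is a semiprime ideal. -/
theorem mem_primeRadical_of_forall_mul_mul_mem {R : Type*} [Ring R] {b : R}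
    (h : ∀ r, b * r * b ∈ primeRadical R) : b ∈ primeRadical R := by
  simp only [primeRadical, Submodule.mem_sInf, Set.mem_ofPred_eq] at h ⊢
  exact fun P hP => (hP.mem_or_mem b b fun r => h r P hP).elim id id

theorem RingEquiv.apply_mem_primeRadical {R : Type*} [Ring R] (e : R ≃+* R) {a : R}
    (ha : a ∈ primeRadical R) : e a ∈ primeRadical R := by
  simp only [primeRadical, Submodule.mem_sInf, Set.mem_ofPred_eq] at ha ⊢
  intro P hP
  have h2 := hP.isTwoSided
  refine ha (Ideal.comap (e : R →+* R) P) ⟨inferInstance, fun h => hP.ne_top ?_, fun a b hab => ?_⟩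
  · rw [Ideal.eq_top_iff_one] at h ⊢
    simpa using h
  · refine hP.mem_or_mem (e a) (e b) fun r => ?_
    obtain ⟨r, rfl⟩ := e.surjective r
    simpa using hab r

theorem RingEquiv.apply_mem_primeRadical_iff {R : Type*} [Ring R] (e : R ≃+* R) {a : R} :
    e a ∈ primeRadical R ↔ a ∈ primeRadical R :=
  ⟨fun h => by simpa using e.symm.apply_mem_primeRadical h, e.apply_mem_primeRadical⟩

end PrimeRadical

/-! ### The q-Leibniz rule and stability of a nilpotent semiprime ideal -/

namespace IsSkewDerivation

section Powers

variable {R : Type*} [Ring R] {σ : R →+* R} {δ : R →+ R} {P : Ideal R}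

/-- The Leibniz rule differentiates one factor of a product at a time and `σ` preserves `P`, so
applying `δ` costs at most one factor of `P`. -/
theorem apply_mem_pow [P.IsTwoSided] (hδ : IsSkewDerivation σ δ) (hσ : ∀ a ∈ P, σ a ∈ P) (k : ℕ) :
    ∀ a ∈ P ^ (k + 1), δ a ∈ P ^ k := by
  induction k with
  | zero => intro a _; simp [Submodule.pow_zero]
  | succ k ih =>
    intro a ha
    rw [Ideal.IsTwoSided.pow_succ] at ha
    induction ha using Submodule.mul_induction_on' with
    | mem_mul_mem a ha b hb =>
      rw [hδ]
      refine Ideal.add_mem _ (Ideal.mul_mem_left _ _ hb) ?_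
      rw [Ideal.IsTwoSided.pow_succ]
      exact Ideal.mul_mem_mul (hσ a ha) (ih b hb)
    | add a _ b _ h1 h2 => rw [map_add]; exact Ideal.add_mem _ h1 h2

theorem iterate_mem_pow [P.IsTwoSided] (hδ : IsSkewDerivation σ δ) (hσ : ∀ a ∈ P, σ a ∈ P)
    (k l : ℕ) : ∀ a ∈ P ^ (k + l), δ^[l] a ∈ P ^ k := by
  induction l with
  | zero => exact fun a ha => ha
  | succ l ih => exact fun a ha => ih _ (hδ.apply_mem_pow hσ (k + l) a ha)

theorem iterate_mem [P.IsTwoSided] (hδ : IsSkewDerivation σ δ) (hσ : ∀ a ∈ P, σ a ∈ P)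
    {k l : ℕ} (h : l < k) {a : R} (ha : a ∈ P ^ k) : δ^[l] a ∈ P := by
  have := hδ.iterate_mem_pow hσ 1 l a (Ideal.pow_le_pow_right (by omega) ha)
  rwa [Ideal.IsTwoSided.pow_succ, Submodule.pow_zero, Ideal.IsTwoSided.mul_one] at this

theorem stable_pow [P.IsTwoSided] (hδ : IsSkewDerivation σ δ) (hσ : ∀ a ∈ P, σ a ∈ P)
    (hP : ∀ a ∈ P, δ a ∈ P) (k : ℕ) : ∀ a ∈ P ^ k, σ a ∈ P ^ k ∧ δ a ∈ P ^ k := by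
  induction k with
  | zero => intro a _; simp [Submodule.pow_zero]
  | succ k ih =>
    intro a ha
    rw [Ideal.IsTwoSided.pow_succ] at ha ⊢
    induction ha using Submodule.mul_induction_on' with
    | mem_mul_mem a ha b hb =>
      rw [hδ, map_mul]
      exact ⟨Ideal.mul_mem_mul (hσ a ha) (ih b hb).1, Ideal.add_mem _
        (Ideal.mul_mem_mul (hP a ha) hb) (Ideal.mul_mem_mul (hσ a ha) (ih b hb).2)⟩
    | add a _ b _ h1 h2 =>
      rw [map_add, map_add]
      exact ⟨Ideal.add_mem _ h1.1 h2.1, Ideal.add_mem _ h1.2 h2.2⟩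

end Powers

variable {F R : Type*} [Field F] [Ring R] [Algebra F R] {σ : R ≃ₐ[F] R} {δ : R →+ R} {q : F}

theorem apply_iterate (hqδ : ∀ r, δ (σ r) = q • σ (δ r)) (i : ℕ) (a : R) :
    δ (σ^[i] a) = q ^ i • σ^[i] (δ a) := by
  induction i with
  | zero => simp
  | succ i ih =>
    rw [Function.iterate_succ_apply', hqδ, ih, map_smul, smul_smul, ← pow_succ',
      Function.iterate_succ_apply']

/-- The two leading terms of the `q`-Leibniz rule. -/
theorem iterate_mul (hδ : IsSkewDerivation ((σ : R ≃+* R) : R →+* R) δ)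
    (hqδ : ∀ r, δ (σ r) = q • σ (δ r)) (a b : R) (i : ℕ) :
    ∃ e ∈ AddSubgroup.closure {s | ∃ y, ∃ l < i, y * δ^[l] b = s},
      δ^[i + 1] (a * b) = σ^[i + 1] a * δ^[i + 1] b +
        (∑ j ∈ Finset.range (i + 1), q ^ j) • (σ^[i] (δ a) * δ^[i] b) + e := by
  have hδ' : ∀ a b, δ (a * b) = δ a * b + σ a * δ b := hδ
  induction i with
  | zero =>
    refine ⟨0, zero_mem _, ?_⟩
    simp [hδ', add_comm]
  | succ i ih =>
    obtain ⟨e, he, h⟩ := ih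
    have he' : δ e ∈ AddSubgroup.closure {s | ∃ y, ∃ l < i + 1, y * δ^[l] b = s} := by
      clear h
      induction he using AddSubgroup.closure_induction with
      | mem s hs =>
        obtain ⟨y, l, hl, rfl⟩ := hs
        rw [hδ', ← Function.iterate_succ_apply' δ]
        exact add_mem (AddSubgroup.subset_closure ⟨_, l, by omega, rfl⟩)
          (AddSubgroup.subset_closure ⟨_, l + 1, by omega, rfl⟩)
      | zero => rw [map_zero]; exact zero_mem _
      | add s t _ _ h1 h2 => rw [map_add]; exact add_mem h1 h2
      | neg s _ h1 => rw [map_neg]; exact neg_mem h1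
    set c := ∑ j ∈ Finset.range (i + 1), q ^ j with hc
    -- Since `δ` is only additive, the scalar `c` stays inside the left factor; its derivative goes
    -- to the error term. Differentiating `σ^[i + 1] a` contributes the new summand `q ^ (i + 1)`.
    refine ⟨δ (c • σ^[i] (δ a)) * δ^[i] b + δ e,
      add_mem (AddSubgroup.subset_closure ⟨_, i, by omega, rfl⟩) he', ?_⟩
    rw [Function.iterate_succ_apply', h, map_add, map_add, hδ', ← smul_mul_assoc, hδ',
      apply_iterate hqδ, map_smul σ, ← Function.iterate_succ_apply' σ,
      ← Function.iterate_succ_apply' δ, ← Function.iterate_succ_apply' σ,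
      ← Function.iterate_succ_apply' δ, Finset.sum_range_succ _ (i + 1), ← hc, add_smul,
      smul_mul_assoc, smul_mul_assoc]
    abel

/-- Under the `q`-skew condition, with `(n!)_q ≠ 0`, a nilpotent semiprime ideal with `P ^ n = 0`
which is stable under `σ` is stable under `δ`. -/
theorem apply_mem_of_pow_eq_bot (hδ : IsSkewDerivation ((σ : R ≃+* R) : R →+* R) δ)
    (hqδ : ∀ r, δ (σ r) = q • σ (δ r)) {P : Ideal R} [P.IsTwoSided]
    (hP : ∀ b, (∀ r, b * r * b ∈ P) → b ∈ P) (hσ : ∀ a, σ a ∈ P ↔ a ∈ P) {n : ℕ}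
    (hn : P ^ n = ⊥) (hfact : qFactorial q n ≠ 0) : ∀ a ∈ P, δ a ∈ P := by
  have hσ' : ∀ a ∈ P, ((σ : R ≃+* R) : R →+* R) a ∈ P := fun a ha => (hσ a).2 ha
  have hσi : ∀ i a, σ^[i] a ∈ P ↔ a ∈ P := by
    intro i
    induction i with
    | zero => exact fun a => Iff.rfl
    | succ i ih => exact fun a => (ih (σ a)).trans (hσ a)
  have hsmul : ∀ (c : F) (a : R), a ∈ P → c • a ∈ P := fun c a ha => by
    rw [Algebra.smul_def]
    exact P.mul_mem_left _ ha
  have hE : ∀ i k b, i ≤ k → b ∈ P ^ k →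
      AddSubgroup.closure {s | ∃ y, ∃ l < i, y * δ^[l] b = s} ≤ P.toAddSubgroup := by
    intro i k b hik hb
    rw [AddSubgroup.closure_le]
    rintro _ ⟨y, l, hl, rfl⟩
    exact P.mul_mem_left y (hδ.iterate_mem hσ' (by omega) hb)
  have step : ∀ k, 1 ≤ k → k + 1 ≤ n → (∀ a ∈ P ^ (k + 1), δ^[k + 1] a ∈ P) →
      ∀ a ∈ P ^ k, δ^[k] a ∈ P := by
    intro k hk hkn ih
    have hqk : ∑ j ∈ Finset.range (k + 1), q ^ j ≠ 0 :=
      Finset.prod_ne_zero_iff.1 hfact (k + 1) (Finset.mem_Icc.2 ⟨by omega, hkn⟩)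
    -- In the expansion of `δ^(k+1)(ab)`, with `p = σ^k(a)`, all terms but the second lie in `P`;
    -- dividing by the `q`-integer leaves `δ(p) δ^k(b) ∈ P`.
    have h1 : ∀ p ∈ P, ∀ b ∈ P ^ k, δ p * δ^[k] b ∈ P := by
      intro p hp b hb
      obtain ⟨a, rfl⟩ := σ.surjective.iterate k p
      have ha : a ∈ P := (hσi k a).1 hp
      obtain ⟨e, he, h⟩ := iterate_mul hδ hqδ a b k
      have hab := ih (a * b) (by rw [Ideal.IsTwoSided.pow_succ]; exact Ideal.mul_mem_mul ha hb)
      rw [h] at hab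
      have h2 := (P.add_mem_iff_left (hE k k b le_rfl hb he)).1 hab
      have h3 := (P.add_mem_iff_right (P.mul_mem_right (δ^[k + 1] b) ((hσi (k + 1) a).2 ha))).1 h2
      have h4 := hsmul (∑ j ∈ Finset.range (k + 1), q ^ j)⁻¹ _ h3
      rw [smul_smul, inv_mul_cancel₀ hqk, one_smul] at h4
      rw [apply_iterate hqδ, smul_mul_assoc]
      exact hsmul _ _ h4
    intro y hy
    obtain ⟨i, rfl⟩ := Nat.exists_eq_add_of_le' hk
    refine hP _ fun r => ?_
    obtain ⟨r, rfl⟩ := σ.surjective.iterate (i + 1) r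
    have hp : δ^[i] y ∈ P := hδ.iterate_mem hσ' i.lt_succ_self hy
    obtain ⟨e, he, h⟩ := iterate_mul hδ hqδ r y i
    -- Taking `p = δ^i(y)` and `b = r y` gives, modulo `P`, the product `δ^k(y) σ^k(r) δ^k(y)`. As
    -- `σ^k` is onto, semiprimeness applies.
    have h2 := h1 _ hp (r * y) (Ideal.mul_mem_left _ r hy)
    rw [← Function.iterate_succ_apply' δ, h, mul_add, mul_add, ← mul_assoc] at h2
    refine (P.add_mem_iff_left (P.mul_mem_left _ (hsmul _ _ (P.mul_mem_left _ hp)))).1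
      ((P.add_mem_iff_left (P.mul_mem_left _ (hE i (i + 1) y i.le_succ hy he))).1 h2)
  rcases Nat.eq_zero_or_pos n with rfl | hpos
  · rw [Submodule.pow_zero, Ideal.one_eq_top] at hn
    intro a _
    have : δ a ∈ (⊤ : Ideal R) := Submodule.mem_top
    rw [hn, Submodule.mem_bot] at this
    rw [this]
    exact P.zero_mem
  · have down : ∀ j, j < n → ∀ a ∈ P ^ (n - j), δ^[n - j] a ∈ P := by
      intro j
      induction j with
      | zero =>
        intro _ a ha
        rw [Nat.sub_zero, hn, Submodule.mem_bot] at ha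
        rw [ha, iterate_map_zero]
        exact P.zero_mem
      | succ j ih =>
        intro hj
        have hj' : n - j = n - (j + 1) + 1 := by omega
        refine step _ (by omega) (by omega) ?_
        rw [← hj']
        exact ih (by omega)
    have h1 := down (n - 1) (by omega)
    rw [show n - (n - 1) = 0 + 1 by omega, Ideal.IsTwoSided.pow_succ, Submodule.pow_zero, Ideal.IsTwoSided.mul_one] at h1
    exact h1

end IsSkewDerivation

/-! ### Reduction modulo a stable ideal, and nilpotency -/

namespace IsFreeSkewExtension

variable {R X S : Type*} [Ring R] [Ring S] {σ : X → R →+* R} {δ : X → R →+ R} {ι : R →+* S}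
  {v : X → S}

/-- Functoriality of free skew extensions in the coefficient ring. -/
theorem exists_map {R' S' : Type*} [Ring R'] [Ring S'] {σ' : X → R' →+* R'} {δ' : X → R' →+ R'}
    {ι' : R' →+* S'} {v' : X → S'} (hS : IsFreeSkewExtension σ δ ι v)
    (hS' : IsFreeSkewExtension σ' δ' ι' v') (π : R →+* R') (hσ : ∀ x r, π (σ x r) = σ' x (π r))
    (hδ : ∀ x r, π (δ x r) = δ' x (π r)) :
    ∃ φ : S →+* S', ∀ s w, hS'.coeff (φ s) w = π (hS.coeff s w) := by
  let φ : S →+ S' := hS'.equiv.toAddMonoidHom.comp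
    ((Finsupp.mapRange.addMonoidHom π.toAddMonoidHom).comp hS.coeff)
  have hφ : ∀ r w, φ (ι r * FreeMonoid.lift v w) = ι' (π r) * FreeMonoid.lift v' w := by
    intro r w
    change hS'.equiv (Finsupp.mapRange.addMonoidHom π.toAddMonoidHom (hS.coeff _)) = _
    rw [coeff_monomial, Finsupp.mapRange.addMonoidHom_apply, Finsupp.mapRange_single, equiv_single]
    rfl
  have hι : ∀ r t, φ (ι r * t) = ι' (π r) * φ t := by
    intro r t
    induction t using hS.induction with
    | zero => simp
    | add s t h1 h2 => rw [mul_add, map_add, map_add, mul_add, h1, h2]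
    | monomial a w => rw [← mul_assoc, ← map_mul, hφ, hφ, map_mul, map_mul, mul_assoc]
  have hv : ∀ x t, φ (v x * t) = v' x * φ t := by
    intro x t
    induction t using hS.induction with
    | zero => simp
    | add s t h1 h2 => rw [mul_add, map_add, map_add, mul_add, h1, h2]
    | monomial a w =>
      rw [← mul_assoc, hS.commutation, add_mul, map_add, mul_assoc, ← FreeMonoid.lift_eval_of v x,
        ← map_mul, hφ, hφ, hφ, map_mul, FreeMonoid.lift_eval_of, ← mul_assoc (v' x),
        hS'.commutation, hσ, hδ, add_mul, mul_assoc]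
  have hw : ∀ w t, φ (FreeMonoid.lift v w * t) = FreeMonoid.lift v' w * φ t := by
    intro w
    induction w using FreeMonoid.inductionOn' with
    | one => simp
    | of_mul x w ih =>
      intro t
      rw [map_mul (FreeMonoid.lift v), map_mul (FreeMonoid.lift v'), FreeMonoid.lift_eval_of,
        FreeMonoid.lift_eval_of, mul_assoc, hv, ih, mul_assoc]
  have hone : φ 1 = 1 := by simpa using hφ 1 1
  have hmul : ∀ s t, φ (s * t) = φ s * φ t := by
    intro s t
    induction s using hS.induction with
    | zero => simp
    | add s s' h1 h2 => rw [add_mul, map_add, map_add, add_mul, h1, h2]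
    | monomial a w => rw [mul_assoc, hι, hw, hφ, mul_assoc]
  refine ⟨{ φ with map_one' := hone, map_mul' := hmul }, fun s w => ?_⟩
  change hS'.coeff (hS'.equiv (Finsupp.mapRange.addMonoidHom π.toAddMonoidHom (hS.coeff s))) w = _
  rw [coeff_equiv]
  rfl

/-- If the coefficients of the elements of `J` lie in a nilpotent ideal stable under the `σ_x` and
`δ_x`, then `J` is nilpotent. -/
theorem pow_eq_bot (hS : IsFreeSkewExtension σ δ ι v) {P : Ideal R} [P.IsTwoSided]
    (hδ : ∀ x, IsSkewDerivation (σ x) (δ x)) (hσP : ∀ x, ∀ a ∈ P, σ x a ∈ P)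
    (hδP : ∀ x, ∀ a ∈ P, δ x a ∈ P) {J : Ideal S} [J.IsTwoSided]
    (hJ : ∀ s ∈ J, ∀ w, hS.coeff s w ∈ P) {n : ℕ} (hn : P ^ n = ⊥) : J ^ n = ⊥ := by
  -- This is `P^k S`. Stability of `P^k` under `σ x` and `δ x` makes it closed under left
  -- multiplication by words, so `J * P^k S ⊆ P^(k+1) S`.
  let N : ℕ → AddSubgroup S := fun k => AddSubgroup.closure {s | ∃ a ∈ P ^ k, ∃ t, ι a * t = s}
  have hιN : ∀ k r, ∀ y ∈ N k, ι r * y ∈ N k := by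
    intro k r y hy
    induction hy using AddSubgroup.closure_induction with
    | mem s hs =>
      obtain ⟨a, ha, t, rfl⟩ := hs
      exact AddSubgroup.subset_closure ⟨r * a, Ideal.mul_mem_left _ r ha, t, by
        rw [map_mul, mul_assoc]⟩
    | zero => rw [mul_zero]; exact zero_mem _
    | add s t _ _ h1 h2 => rw [mul_add]; exact add_mem h1 h2
    | neg s _ h1 => rw [mul_neg]; exact neg_mem h1
  have hvN : ∀ k x, ∀ y ∈ N k, v x * y ∈ N k := by
    intro k x y hy
    induction hy using AddSubgroup.closure_induction with
    | mem s hs =>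
      obtain ⟨a, ha, t, rfl⟩ := hs
      obtain ⟨h1, h2⟩ := (hδ x).stable_pow (hσP x) (hδP x) k a ha
      rw [← mul_assoc, hS.commutation, add_mul, mul_assoc]
      exact add_mem (AddSubgroup.subset_closure ⟨_, h1, _, rfl⟩)
        (AddSubgroup.subset_closure ⟨_, h2, _, rfl⟩)
    | zero => rw [mul_zero]; exact zero_mem _
    | add s t _ _ h1 h2 => rw [mul_add]; exact add_mem h1 h2
    | neg s _ h1 => rw [mul_neg]; exact neg_mem h1
  have hwN : ∀ k w, ∀ y ∈ N k, FreeMonoid.lift v w * y ∈ N k := by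
    intro k w
    induction w using FreeMonoid.inductionOn' with
    | one => intro y hy; rwa [map_one, one_mul]
    | of_mul x w ih =>
      intro y hy
      rw [map_mul, FreeMonoid.lift_eval_of, mul_assoc]
      exact hvN k x _ (ih y hy)
  have hPN : ∀ k, ∀ a ∈ P, ∀ y ∈ N k, ι a * y ∈ N (k + 1) := by
    intro k a ha y hy
    induction hy using AddSubgroup.closure_induction with
    | mem s hs =>
      obtain ⟨b, hb, t, rfl⟩ := hs
      exact AddSubgroup.subset_closure ⟨a * b, by
        rw [Ideal.IsTwoSided.pow_succ]; exact Ideal.mul_mem_mul ha hb, t, by rw [map_mul, mul_assoc]⟩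
    | zero => rw [mul_zero]; exact zero_mem _
    | add s t _ _ h1 h2 => rw [mul_add]; exact add_mem h1 h2
    | neg s _ h1 => rw [mul_neg]; exact neg_mem h1
  have hJN : ∀ k, ∀ y ∈ J ^ k, y ∈ N k := by
    intro k
    induction k with
    | zero => exact fun y _ => AddSubgroup.subset_closure ⟨1, by simp [Submodule.pow_zero], y, by simp⟩
    | succ k ih =>
      intro y hy
      rw [Ideal.IsTwoSided.pow_succ] at hy
      induction hy using Submodule.mul_induction_on' with
      | mem_mul_mem s hs t ht =>
        rw [hS.eq_sum s, Finsupp.sum, Finset.sum_mul]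
        refine sum_mem fun w _ => ?_
        rw [mul_assoc]
        exact hPN k _ (hJ s hs w) _ (hwN k w t (ih t ht))
      | add s _ t _ h1 h2 => exact add_mem h1 h2
  rw [eq_bot_iff]
  intro y hy
  have hy := hJN n y hy
  have hN : N n ≤ ⊥ := by
    rw [AddSubgroup.closure_le]
    rintro _ ⟨a, ha, t, rfl⟩
    rw [hn, Submodule.mem_bot] at ha
    simp [ha]
  exact hN hy

/-- If `P` is a two-sided ideal, stable under the `σ_x^{±1}` and `δ_x`, with `R ⧸ P` semiprime left
Goldie, then the elements of the Jacobson radical of the free skew extension have all their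
coefficients in `P`. -/
theorem coeff_mem_of_mem_jacobson [Nonempty X] (hS : IsFreeSkewExtension σ δ ι v) {P : Ideal R}
    [P.IsTwoSided] (hσ : ∀ x, Function.Surjective (σ x)) (hδ : ∀ x, IsSkewDerivation (σ x) (δ x))
    (hσP : ∀ x a, σ x a ∈ P ↔ a ∈ P) (hδP : ∀ x, ∀ a ∈ P, δ x a ∈ P)
    (hP : ∀ b, (∀ r, b * r * b ∈ P) → b ∈ P) (hG : IsLeftGoldie (R ⧸ P)) {s : S}
    (hs : s ∈ Ring.jacobson S) (w : FreeMonoid X) : hS.coeff s w ∈ P := by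
  let π := Ideal.Quotient.mk P
  have hπ : Function.Surjective π := Ideal.Quotient.mk_surjective
  let σ' : X → R ⧸ P →+* R ⧸ P := fun x =>
    Ideal.quotientMap P (σ x) fun a ha => (hσP x a).2 ha
  let δ' : X → R ⧸ P →+ R ⧸ P := fun x =>
    QuotientAddGroup.lift P.toAddSubgroup (π.toAddMonoidHom.comp (δ x))
      fun a ha => Ideal.Quotient.eq_zero_iff_mem.2 (hδP x a ha)
  have hσ' : ∀ x r, π (σ x r) = σ' x (π r) := fun x r => rfl
  have hδ' : ∀ x r, π (δ x r) = δ' x (π r) := fun x r => rfl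
  have hder : ∀ x, IsSkewDerivation (σ' x) (δ' x) := by
    intro x a b
    obtain ⟨a, rfl⟩ := hπ a
    obtain ⟨b, rfl⟩ := hπ b
    rw [← map_mul, ← hδ', hδ x a b, map_add, map_mul, map_mul, hδ', hδ', hσ']
  have hbij : ∀ x, Function.Bijective (σ' x) := by
    intro x
    constructor
    · rw [injective_iff_map_eq_zero]
      intro a ha
      obtain ⟨a, rfl⟩ := hπ a
      rw [← hσ', Ideal.Quotient.eq_zero_iff_mem, hσP] at ha
      exact Ideal.Quotient.eq_zero_iff_mem.2 ha
    · intro b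
      obtain ⟨b, rfl⟩ := hπ b
      obtain ⟨a, rfl⟩ := hσ x b
      exact ⟨π a, rfl⟩
  have hsemi : ∀ b : R ⧸ P, (∀ r, b * r * b = 0) → b = 0 := by
    intro b hb
    obtain ⟨b, rfl⟩ := hπ b
    exact Ideal.Quotient.eq_zero_iff_mem.2 (hP b fun r => Ideal.Quotient.eq_zero_iff_mem.1 (by
      rw [map_mul, map_mul]; exact hb (π r)))
  obtain ⟨S', _, ι', v', hS'⟩ := exists_isFreeSkewExtension σ' δ' hder
  obtain ⟨φ, hφ⟩ := hS.exists_map hS' π hσ' hδ'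
  have hφs : Function.Surjective φ := by
    intro t
    obtain ⟨p, hp⟩ := Finsupp.mapRange_surjective π (map_zero π) hπ (hS'.coeff t)
    refine ⟨hS.equiv p, hS'.coeff_injective (Finsupp.ext fun w => ?_)⟩
    rw [hφ, coeff_equiv, ← hp, Finsupp.mapRange_apply]
  have : RingHomSurjective φ := ⟨hφs⟩
  -- A surjective ring homomorphism maps the Jacobson radical into the Jacobson radical, which is
  -- zero over the semiprime quotient.
  have h0 : φ s ∈ Ring.jacobson S' := Ring.le_comap_jacobson φ hs
  rw [hS'.jacobson_eq_bot hG hsemi hbij hder, Submodule.mem_bot] at h0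
  have h1 := hφ s w
  rw [h0, map_zero, Finsupp.zero_apply] at h1
  exact Ideal.Quotient.eq_zero_iff_mem.1 h1.symm

end IsFreeSkewExtension

theorem mainTheorem4 {F R X S : Type*} [Field F] [Ring R] [Algebra F R] [Nonempty X] [Ring S]
    (σ : X → R ≃ₐ[F] R) (δ : X → R →+ R)
    (hδ : ∀ x, IsSkewDerivation ((σ x : R ≃+* R) : R →+* R) (δ x))
    (n : ℕ) (hnil : IsNilpotent (primeRadical R)) (hn : nilpotencyClass (primeRadical R) = n)
    (hGoldie : IsLeftGoldie (R ⧸ primeRadical R))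
    (q : X → F) (hq : ∀ x, q x ≠ 0)
    (hqδ : ∀ x r, δ x (σ x r) = q x • σ x (δ x r))
    (hfact : ∀ x, qFactorial (q x) n ≠ 0)
    (ι : R →+* S) (v : X → S)
    (hS : IsFreeSkewExtension (fun x => ((σ x : R ≃+* R) : R →+* R)) δ ι v) :
    IsNilpotent (Ring.jacobson S) := by
  have hpow : primeRadical R ^ n = ⊥ := hn ▸ pow_nilpotencyClass hnil
  have hP : ∀ b : R, (∀ r, b * r * b ∈ primeRadical R) → b ∈ primeRadical R :=
    fun _ => mem_primeRadical_of_forall_mul_mul_mem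
  have hσP : ∀ x a, σ x a ∈ primeRadical R ↔ a ∈ primeRadical R := fun x _ =>
    (σ x : R ≃+* R).apply_mem_primeRadical_iff
  have hδP : ∀ x, ∀ a ∈ primeRadical R, δ x a ∈ primeRadical R := fun x =>
    (hδ x).apply_mem_of_pow_eq_bot (hqδ x) hP (hσP x) hpow (hfact x)
  exact ⟨n, hS.pow_eq_bot hδ (fun x a => (hσP x a).2) hδP
    (fun _ hs => hS.coeff_mem_of_mem_jacobson (fun x => (σ x).surjective) hδ hσP hδP hP hGoldie hs)
    hpow⟩
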